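/- Let $(R,\mathfrak m)$ be a commutative Noetherian local ring of Krull dimension $d$. All modules are finitely generated. Notation. For $M\neq 0$, $\operatorname{depth} M$ is the supremum of the lengths of the $M$-regular sequences in $\mathfrak m$, and $\operatorname{depth} 0=\infty$. $\operatorname{mod}_0(R)$ is the full subcategory of the finitely generated $R$-modules $M$ that are locally free on the punctured spectrum, i.e. $M_{\mathfrak p}$ is a free $R_{\mathfrak p}$-module for every non-maximal prime $\mathfrak p$. For a minimal free resolution $\cdots\to F_1\xrightarrow{d_1}F_0\to M\to 0$ the transpose is $\operatorname{Tr}M=\operatorname{Coker}(\operatorname{Hom}_R(d_1,R))$; $M$ is $n$-torsionfree if $\operatorname{Ext}^i_R(\operatorname{Tr}M,R)=0$ for all $1\le i\le n$. Let $\mathsf{TF}_n^0(R)$ be the full subcategory of $n$-torsionfree modules in $\operatorname{mod}_0(R)$. Let $\widetilde{\mathsf S}{}_n^0(R)$ be the full subcategory of those $M\in\operatorname{mod}_0(R)$ with $\operatorname{depth}(M_{\mathfrak p})\ge\min\{n,\operatorname{depth}(R_{\mathfrak p})\}$ for all primes $\mathfrak p$. Let $\mathsf{CM}(R)$ be the full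 subcategory of the finitely generated modules $M$ with $\operatorname{depth}(M_{\mathfrak p})\ge\dim(R_{\mathfrak p})$ for all primes $\mathfrak p$, let $\mathsf{CM}_0(R)=\mathsf{CM}(R)\cap\operatorname{mod}_0(R)$, and call $R$ Cohen–Macaulay if $R\in\mathsf{CM}(R)$. For a full subcategory $\mathcal X$, $\Omega\mathcal X$ consists of the finitely generated modules $M$ for which there is a short exact sequence $0\to M\to P\to X\to 0$ with $X\in\mathcal X$ and $P$ finitely generated projective. Then: 1. For each integer $n$ with $0\le n\le\operatorname{depth}(R)$, $$\mathsf{TF}_n^0(R)=\widetilde{\mathsf S}{}_n^0(R)=\{M\in\operatorname{mod}_0(R)\mid\operatorname{depth}(M)\ge n\}.$$ 2. For each integer $n$ with $0\le n\le\operatorname{depth}(R)$, $$\mathsf{TF}_{n+1}^0(R)=\Omega\,\mathsf{TF}_n^0(R)=\Omega\,\widetilde{\mathsf S}{}_n^0(R).$$ 3. If, in addition, $R$ is Cohen–Macaulay, then $$\mathsf{TF}_d^0(R)=\widetilde{\mathsf S}{}_d^0(R)=\mathsf{CM}_0(R)\quad\text{and}\quad \mathsf{TF}_{d+1}^0(R)=\Omega\,\widetilde{\mathsf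 S}{}_d^0(R)=\Omega\,\mathsf{CM}_0(R).$$ -/

import Mathlib

open CategoryTheory IsLocalRing

universe u v

noncomputable section

namespace LocalAlg

/-! ### Depth -/

/-- The depth of a finitely generated module `M` over a Noetherian local ring `(R, 𝔪)`: the
supremum of the lengths of the `M`-regular sequences in `𝔪`. For `M ≠ 0` finitely generated, a
weakly regular sequence in `𝔪` is regular by Nakayama's lemma; for `M = 0` every sequence is
weakly regular, which gives the convention `depth 0 = ∞`. -/
def depth (R : Type u) [CommRing R] [IsLocalRing R] (M : Type v) [AddCommGroup M] [Module R M] :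
    ℕ∞ :=
  sSup {l : ℕ∞ | ∃ rs : List R, (∀ r ∈ rs, r ∈ maximalIdeal R) ∧
    RingTheory.Sequence.IsWeaklyRegular M rs ∧ (rs.length : ℕ∞) = l}

/-- The depth of `M_𝔭` as a module over the local ring `R_𝔭`. -/
def depthAt {R : Type u} [CommRing R] (p : Ideal R) [p.IsPrime] (M : Type v) [AddCommGroup M]
    [Module R M] : ℕ∞ :=
  depth (Localization.AtPrime p) (LocalizedModule.AtPrime p M)

/-! ### The Auslander transpose -/

/-- The beginning `Rᵐ --d--> Rⁿ --π--> M → 0` of a minimal free resolution of `M` over the local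
ring `(R, 𝔪)`: the sequence is exact, and the kernels of `π` and of `d` (the images of the first
and of the second differential of the resolution) lie in `𝔪 Rⁿ` and `𝔪 Rᵐ`. -/
structure MinimalPresentation (R : Type u) [CommRing R] [IsLocalRing R] (M : Type v)
    [AddCommGroup M] [Module R M] where
  n : ℕ
  m : ℕ
  π : (Fin n → R) →ₗ[R] M
  d : (Fin m → R) →ₗ[R] (Fin n → R)
  surjective_π : Function.Surjective π
  exact : Function.Exact d π
  ker_π_le : LinearMap.ker π ≤ maximalIdeal R • (⊤ : Submodule R (Fin n → R))
  ker_d_le : LinearMap.ker d ≤ maximalIdeal R • (⊤ : Submodule R (Fin m → R))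

theorem exists_minimal_cover (R : Type u) [CommRing R] [IsLocalRing R] (M : Type v)
    [AddCommGroup M] [Module R M] [Module.Finite R M] :
    ∃ (n : ℕ) (π : (Fin n → R) →ₗ[R] M), Function.Surjective π ∧
      LinearMap.ker π ≤ maximalIdeal R • (⊤ : Submodule R (Fin n → R)) := by
  classical
  have hex : ∃ n : ℕ, ∃ π : (Fin n → R) →ₗ[R] M, Function.Surjective π :=
    Module.Finite.exists_fin' R M
  obtain ⟨π, hπ⟩ := Nat.find_spec hex
  have hmin : ∀ k, k < Nat.find hex → ¬ ∃ π : (Fin k → R) →ₗ[R] M, Function.Surjective π :=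
    fun k hk => Nat.find_min hex hk
  generalize Nat.find hex = n at π hπ hmin
  refine ⟨n, π, hπ, fun a ha => ?_⟩
  by_cases hall : ∀ i, a i ∈ maximalIdeal R
  · rw [pi_eq_sum_univ' a]
    exact Submodule.sum_mem _ fun i _ => Submodule.smul_mem_smul (hall i) trivial
  · exfalso
    push Not at hall
    obtain ⟨j, hj⟩ := hall
    have hu : IsUnit (a j) := by simpa using hj
    obtain ⟨c, hc⟩ := hu.exists_left_inv
    obtain _ | k := n
    · exact j.elim0
    refine hmin k (Nat.lt_succ_self k) ⟨Fintype.linearCombination R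
      (fun i => π (Pi.single (j.succAbove i) 1)), fun y => ?_⟩
    obtain ⟨b, rfl⟩ := hπ y
    let b' : Fin (k + 1) → R := b - (b j * c) • a
    have hb' : π b' = π b := by
      simp only [b', map_sub, map_smul, LinearMap.mem_ker.mp ha, smul_zero, sub_zero]
    have hb'j : b' j = 0 := by
      simp only [b', Pi.sub_apply, Pi.smul_apply, smul_eq_mul, mul_assoc, hc, mul_one, sub_self]
    refine ⟨fun i => b' (j.succAbove i), ?_⟩
    rw [← hb', Fintype.linearCombination_apply]
    conv_rhs => rw [LinearMap.pi_apply_eq_sum_univ π b', Fin.sum_univ_succAbove _ j, hb'j]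
    simp only [zero_smul, zero_add]
    refine Finset.sum_congr rfl fun i _ => ?_
    congr 2
    ext l
    simp [Pi.single_apply, eq_comm]

theorem nonempty_minimalPresentation (R : Type u) [CommRing R] [IsLocalRing R]
    [IsNoetherianRing R] (M : Type v) [AddCommGroup M] [Module R M] [Module.Finite R M] :
    Nonempty (MinimalPresentation R M) := by
  obtain ⟨n, π, hπ, hkπ⟩ := exists_minimal_cover R M
  obtain ⟨m, e, he, hke⟩ := exists_minimal_cover R (LinearMap.ker π)
  refine ⟨⟨n, m, π, (LinearMap.ker π).subtype ∘ₗ e, hπ, ?_, hkπ, ?_⟩⟩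
  · rw [LinearMap.exact_iff, LinearMap.range_comp, LinearMap.range_eq_top.mpr he,
      Submodule.map_top, Submodule.range_subtype]
  · rwa [LinearMap.ker_comp_of_ker_eq_bot _ (Submodule.ker_subtype _)]

/-- The cokernel of the dual `d* : (Rⁿ)* → (Rᵐ)*` of `d`. -/
abbrev MinimalPresentation.coker {R : Type u} [CommRing R] [IsLocalRing R] {M : Type v}
    [AddCommGroup M] [Module R M] (P : MinimalPresentation R M) : Type u :=
  Module.Dual R (Fin P.m → R) ⧸ LinearMap.range P.d.dualMap

/-- The Auslander transpose `Tr M` of a finitely generated module over a Noetherian local ring,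
the cokernel of `d*` for a minimal free presentation of `M`. The presentation is unique up to
isomorphism, and one is chosen. -/
abbrev transpose (R : Type u) [CommRing R] [IsLocalRing R] [IsNoetherianRing R] (M : Type v)
    [AddCommGroup M] [Module R M] [Module.Finite R M] : Type u :=
  (nonempty_minimalPresentation R M).some.coker

/-- `M` is `n`-torsionfree: `Ext^i(Tr M, R) = 0` for all `1 ≤ i ≤ n`. -/
def IsTorsionfree (n : ℕ) (R : Type u) [CommRing R] [IsLocalRing R] [IsNoetherianRing R]
    (M : Type v) [AddCommGroup M] [Module R M] [Module.Finite R M] : Prop :=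
  ∀ i : ℕ, 1 ≤ i → i ≤ n →
    Subsingleton (Abelian.Ext (ModuleCat.of R (transpose R M)) (ModuleCat.of R R) i)

/-! ### Full subcategories of the category of finitely generated modules -/

/-- `mod₀(R)`: the finitely generated modules that are locally free on the punctured spectrum. -/
def modZero (R : Type u) [CommRing R] : ObjectProperty (ModuleCat.{u} R) := fun M =>
  Module.Finite R M ∧ ∀ (p : Ideal R) [p.IsPrime], ¬ p.IsMaximal →
    Module.Free (Localization.AtPrime p) (LocalizedModule.AtPrime p M)

/-- `TF_n(R)`: the finitely generated `n`-torsionfree modules. -/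
def TF (R : Type u) [CommRing R] [IsLocalRing R] [IsNoetherianRing R] (n : ℕ) :
    ObjectProperty (ModuleCat.{u} R) := fun M =>
  ∃ _ : Module.Finite R M, IsTorsionfree n R M

/-- `TF_n^0(R) = TF_n(R) ∩ mod₀(R)`. -/
def TFZero (R : Type u) [CommRing R] [IsLocalRing R] [IsNoetherianRing R] (n : ℕ) :
    ObjectProperty (ModuleCat.{u} R) :=
  TF R n ⊓ modZero R

/-- `S̃_n(R)`: the finitely generated modules `M` with `depth M_𝔭 ≥ min {n, depth R_𝔭}` for all
prime ideals `𝔭`. -/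
def STilde (R : Type u) [CommRing R] (n : ℕ) : ObjectProperty (ModuleCat.{u} R) := fun M =>
  Module.Finite R M ∧ ∀ (p : Ideal R) [p.IsPrime], min (n : ℕ∞) (depthAt p R) ≤ depthAt p M

/-- `S̃_n^0(R) = S̃_n(R) ∩ mod₀(R)`. -/
def STildeZero (R : Type u) [CommRing R] (n : ℕ) : ObjectProperty (ModuleCat.{u} R) :=
  STilde R n ⊓ modZero R

/-- `{M ∈ mod₀(R) | depth M ≥ n}`. -/
def modZeroDepthGE (R : Type u) [CommRing R] [IsLocalRing R] (n : ℕ) :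
    ObjectProperty (ModuleCat.{u} R) := fun M =>
  modZero R M ∧ (n : ℕ∞) ≤ depth R M

/-- `CM(R)`: the maximal Cohen–Macaulay modules, that is, the finitely generated modules `M` with
`depth M_𝔭 ≥ dim R_𝔭` for all prime ideals `𝔭`. -/
def CM (R : Type u) [CommRing R] : ObjectProperty (ModuleCat.{u} R) := fun M =>
  Module.Finite R M ∧ ∀ (p : Ideal R) [p.IsPrime],
    ringKrullDim (Localization.AtPrime p) ≤ (depthAt p M : WithBot ℕ∞)

/-- `CM₀(R) = CM(R) ∩ mod₀(R)`. -/
def CMZero (R : Type u) [CommRing R] : ObjectProperty (ModuleCat.{u} R) :=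
  CM R ⊓ modZero R

/-- The (Noetherian) ring `R` is Cohen–Macaulay: `R ∈ CM(R)`. -/
def IsCohenMacaulay (R : Type u) [CommRing R] : Prop :=
  CM R (ModuleCat.of R R)

/-- `Ω𝒳`: the finitely generated modules `M` that are a first syzygy of some `X ∈ 𝒳`, that is, fit
into a short exact sequence `0 → M → P → X → 0` with `P` finitely generated projective. -/
def syzygy {R : Type u} [CommRing R] (𝒳 : ObjectProperty (ModuleCat.{u} R)) :
    ObjectProperty (ModuleCat.{u} R) := fun M =>
  Module.Finite R M ∧ ∃ (X P : ModuleCat.{u} R) (f : M →ₗ[R] P) (g : P →ₗ[R] X),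
    𝒳 X ∧ Module.Finite R P ∧ Module.Projective R P ∧
      Function.Injective f ∧ Function.Exact f g ∧ Function.Surjective g

end LocalAlg

end

open LocalAlg

noncomputable section

namespace LocalAlg

/-! ### Depth through regular sequences and through `Ext` -/

/-! Call `j : M → F`, with `F` finite free, a pushforward if it is injective and every linear form
on `M` extends along it. For a presentation `F₁ → F₀ → M` and any `j` along which linear forms
extend, there is an exact sequence `0 → coker (jπ)* → F₁* → Tr M → 0`, whose left term is a
transpose of `coker j`. So `Ext¹(Tr M, R) = 0` says that `j` is injective, and the higher `Ext` of
`Tr M` are those of `Tr (coker j)` shifted by one. Hence `n`-torsionfree means that `n` successive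
pushforwards exist (`subsingleton_ext_coker_dualMap_iff`).

Being locally free on the punctured spectrum means that each `x ∈ 𝔪` has a power acting on `M`
through a finite free module (`modZero_iff`). This property passes to cokernels of maps along which
linear forms extend and to syzygies, and it makes such a map injective as soon as `depth M ≥ 1`.
While `n ≤ depth R`, a pushforward lowers the depth bound by exactly one, so induction identifies
`TF_n^0` with `depth ≥ n`. The conditions defining `S̃_n` and `CM` then matter only at `𝔪`, since
`M_𝔭` is free at the other primes.

For `n + 1`, which may exceed `depth R`, a pushforward exhibits `M` as a syzygy. Conversely, a
syzygy embedding `M → P` is enlarged to a pushforward `M → F × P`, whose cokernel is an extension of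
`X` by `F` and so still has depth at least `n`. The Cohen–Macaulay case is `n = d`. -/

theorem natCast_le_depth_iff {R : Type u} [CommRing R] [IsLocalRing R] {M : Type v}
    [AddCommGroup M] [Module R M] {n : ℕ} :
    (n : ℕ∞) ≤ depth R M ↔ ∃ rs : List R, (∀ r ∈ rs, r ∈ maximalIdeal R) ∧
      RingTheory.Sequence.IsWeaklyRegular M rs ∧ rs.length = n := by
  constructor
  · intro h
    obtain _ | n := n
    · exact ⟨[], by simp, by simp, rfl⟩
    have hlt : (n : ℕ∞) < depth R M :=
      lt_of_lt_of_le (by exact_mod_cast Nat.lt_succ_self n) h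
    obtain ⟨_, ⟨rs, hrs, hreg, rfl⟩, hn⟩ := lt_sSup_iff.mp hlt
    -- The supremum only yields a sequence of length greater than `n`, so it is truncated; a prefix
    -- of a weakly regular sequence is weakly regular.
    refine ⟨rs.take (n + 1), fun r hr => hrs r (List.mem_of_mem_take hr), ?_, ?_⟩
    · rw [← List.take_append_drop (n + 1) rs,
        RingTheory.Sequence.isWeaklyRegular_append_iff] at hreg
      exact hreg.1
    · have : n < rs.length := by exact_mod_cast hn
      rw [List.length_take]
      omega
  · rintro ⟨rs, hrs, hreg, rfl⟩
    exact le_sSup ⟨rs, hrs, hreg, rfl⟩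

theorem le_of_forall_natCast_le {a b : ℕ∞} (h : ∀ n : ℕ, (n : ℕ∞) ≤ a → (n : ℕ∞) ≤ b) :
    a ≤ b :=
  ENat.forall_natCast_le_iff_le.mp h

theorem depth_congr {R : Type u} [CommRing R] [IsLocalRing R] {M N : Type*} [AddCommGroup M]
    [Module R M] [AddCommGroup N] [Module R N] (e : M ≃ₗ[R] N) : depth R M = depth R N := by
  simp only [depth, e.isWeaklyRegular_congr]

theorem depth_le_depth_of_flat {R : Type u} [CommRing R] [IsLocalRing R] (M : Type v)
    [AddCommGroup M] [Module R M] [Module.Flat R M] : depth R R ≤ depth R M := by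
  refine le_of_forall_natCast_le fun n h => ?_
  obtain ⟨rs, hrs, hreg, hn⟩ := natCast_le_depth_iff.mp h
  refine natCast_le_depth_iff.mpr ⟨rs, hrs, ?_, hn⟩
  exact ((TensorProduct.rid R M).isWeaklyRegular_congr rs).mp
    (hreg.isWeaklyRegular_lTensor (M₂ := M))

/-- Elements outside `𝔪` are units, so `R → R_𝔪` and `M → M_𝔪` are bijective and weakly regular
sequences correspond. -/
theorem depthAt_maximalIdeal {R : Type u} [CommRing R] [IsLocalRing R] (p : Ideal R) [p.IsPrime]
    (hp : p.IsMaximal) (M : Type v) [AddCommGroup M] [Module R M] :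
    depthAt p M = depth R M := by
  obtain rfl : p = maximalIdeal R := eq_maximalIdeal hp
  have hunit : (maximalIdeal R).primeCompl ≤ IsUnit.submonoid R := fun x hx => by
    rw [IsUnit.mem_submonoid_iff]
    simpa [Ideal.primeCompl] using hx
  let e : R ≃ₐ[R] Localization.AtPrime (maximalIdeal R) := IsLocalization.atUnits R _ hunit
  let f := LocalizedModule.mkLinearMap (maximalIdeal R).primeCompl M
  have hbij : Function.Bijective f := by
    have : IsLocalization (maximalIdeal R).primeCompl R := IsLocalization.self hunit
    have := isLocalizedModule_id (maximalIdeal R).primeCompl M R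
    have hf : f = (IsLocalizedModule.linearEquiv (maximalIdeal R).primeCompl
        (LinearMap.id : M →ₗ[R] M) f).toLinearMap :=
      LinearMap.ext fun z => (IsLocalizedModule.linearEquiv_apply _ LinearMap.id f z).symm
    rw [hf]
    exact LinearEquiv.bijective _
  let g : M ≃ₗ[R] LocalizedModule.AtPrime (maximalIdeal R) M := LinearEquiv.ofBijective f hbij
  have hmem : ∀ r : R, algebraMap R (Localization.AtPrime (maximalIdeal R)) r ∈
      maximalIdeal (Localization.AtPrime (maximalIdeal R)) ↔ r ∈ maximalIdeal R := fun r =>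
    IsLocalization.AtPrime.to_map_mem_maximal_iff _ (maximalIdeal R) r
  have hreg : ∀ rs : List R, RingTheory.Sequence.IsWeaklyRegular
      (LocalizedModule.AtPrime (maximalIdeal R) M)
      (rs.map (algebraMap R (Localization.AtPrime (maximalIdeal R)))) ↔
      RingTheory.Sequence.IsWeaklyRegular M rs := fun rs =>
    (RingTheory.Sequence.isWeaklyRegular_map_algebraMap_iff _ _ rs).trans
      (g.isWeaklyRegular_congr rs).symm
  apply le_antisymm
  · refine le_of_forall_natCast_le fun n h => ?_
    obtain ⟨rs, hrs, hr, hn⟩ := natCast_le_depth_iff.mp h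
    obtain ⟨rs, rfl⟩ : ∃ l : List R,
        l.map (algebraMap R (Localization.AtPrime (maximalIdeal R))) = rs :=
      List.map_surjective_iff.mpr (fun x => ⟨e.symm x, by
        rw [← e.toAlgHom.commutes] ; simp⟩) rs
    refine natCast_le_depth_iff.mpr ⟨rs, fun r h => ?_, (hreg rs).mp hr, by simpa using hn⟩
    exact (hmem r).mp (hrs _ (List.mem_map_of_mem h))
  · refine le_of_forall_natCast_le fun n h => ?_
    obtain ⟨rs, hrs, hr, hn⟩ := natCast_le_depth_iff.mp h
    refine natCast_le_depth_iff.mpr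
      ⟨rs.map (algebraMap R _), fun r h => ?_, (hreg rs).mpr hr, by simpa using hn⟩
    obtain ⟨x, hx, rfl⟩ := List.mem_map.mp h
    exact (hmem x).mpr (hrs x hx)

/-- Rees's theorem. Nakayama's lemma turns weakly regular into regular for `M ≠ 0`; for `M = 0` both
sides hold for every `n`. -/
theorem natCast_le_depth_iff_subsingleton_ext {R : Type u} [CommRing R] [IsLocalRing R]
    [IsNoetherianRing R] {M : Type u} [AddCommGroup M] [Module R M] [Module.Finite R M] {n : ℕ} :
    (n : ℕ∞) ≤ depth R M ↔ ∀ i < n, Subsingleton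
      (Abelian.Ext (ModuleCat.of R (ResidueField R)) (ModuleCat.of R M) i) := by
  have hsupp : Module.support R (ResidueField R) =
      PrimeSpectrum.zeroLocus (maximalIdeal R : Set R) := by
    have : Module.Finite R (R ⧸ maximalIdeal R) := inferInstance
    change Module.support R (R ⧸ maximalIdeal R) = _
    rw [Module.support_eq_zeroLocus, Ideal.annihilator_quotient]
  have : Module.Finite R (ResidueField R) :=
    inferInstanceAs (Module.Finite R (R ⧸ maximalIdeal R))
  rw [natCast_le_depth_iff]
  rcases subsingleton_or_nontrivial M with hM | hM
  · refine iff_of_true ⟨List.replicate n 0, ?_, ?_, by simp⟩ fun i _ => ?_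
    · intro r hr
      rw [List.eq_of_mem_replicate hr]
      exact zero_mem _
    · rw [RingTheory.Sequence.isWeaklyRegular_iff]
      intro i hi x y _
      exact Subsingleton.elim _ _
    · have hz : Limits.IsZero (ModuleCat.of R M) := ModuleCat.isZero_of_subsingleton _
      refine subsingleton_of_forall_eq 0 fun x => ?_
      rw [← x.comp_mk₀_id, hz.eq_of_src (𝟙 _) 0]
      simp
  · have hlt : maximalIdeal R • (⊤ : Submodule R M) < ⊤ := by
      refine lt_top_iff_ne_top.mpr (Ne.symm ?_)
      exact Submodule.top_ne_ideal_smul_of_le_jacobson_annihilator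
        (IsLocalRing.maximalIdeal_le_jacobson _)
    constructor
    · rintro ⟨rs, hrs, hreg, rfl⟩
      exact ModuleCat.subsingleton_ext_of_exists_isRegular (maximalIdeal R)
        (ModuleCat.of R (ResidueField R)) hsupp.le (ModuleCat.of R M) hlt rs hrs
        ((isRegular_iff_isWeaklyRegular_of_subset_maximalIdeal hrs).mpr hreg)
    · intro h
      obtain ⟨rs, hn, hrs, hreg⟩ := ModuleCat.exists_isRegular_of_exists_subsingleton_ext
        (maximalIdeal R) n (ModuleCat.of R M) hlt (ModuleCat.of R (ResidueField R)) hsupp h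
      exact ⟨rs, hrs, hreg.toIsWeaklyRegular, hn⟩

/-- The short exact sequence of module categories given by an exact sequence of linear maps. -/
theorem shortExact_of_exact {R : Type u} [CommRing R] {A B C : Type u} [AddCommGroup A]
    [Module R A] [AddCommGroup B] [Module R B] [AddCommGroup C] [Module R C] {f : A →ₗ[R] B}
    {g : B →ₗ[R] C} (hf : Function.Injective f) (hfg : Function.Exact f g)
    (hg : Function.Surjective g) :
    (ShortComplex.mk (ModuleCat.ofHom f) (ModuleCat.ofHom g)
      (by ext x; exact hfg.apply_apply_eq_zero x)).ShortExact where
  exact := ModuleCat.shortComplex_exact _ hfg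
  mono_f := (ModuleCat.mono_iff_injective _).mpr hf
  epi_g := (ModuleCat.epi_iff_surjective _).mpr hg

/-! ### The depth lemma for short exact sequences -/

section ShortExact

variable {R : Type u} [CommRing R] [IsLocalRing R] [IsNoetherianRing R] {A B C : Type u}
  [AddCommGroup A] [Module R A] [Module.Finite R A] [AddCommGroup B] [Module R B]
  [Module.Finite R B] [AddCommGroup C] [Module R C] [Module.Finite R C] {f : A →ₗ[R] B}
  {g : B →ₗ[R] C} {n : ℕ}

theorem natCast_le_depth_middle (hf : Function.Injective f) (hfg : Function.Exact f g)
    (hg : Function.Surjective g) (hA : (n : ℕ∞) ≤ depth R A) (hC : (n : ℕ∞) ≤ depth R C) :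
    (n : ℕ∞) ≤ depth R B := by
  rw [natCast_le_depth_iff_subsingleton_ext] at *
  intro i hi
  have := hA i hi
  have := hC i hi
  refine subsingleton_of_forall_eq 0 fun x => ?_
  obtain ⟨y, rfl⟩ := Abelian.Ext.covariant_sequence_exact₂ _ (shortExact_of_exact hf hfg hg) x
    (Subsingleton.elim (α := Abelian.Ext _ (ModuleCat.of R C) i) _ _)
  rw [Subsingleton.elim (α := Abelian.Ext _ (ModuleCat.of R A) i) y 0]
  simp

theorem natCast_le_depth_left (hf : Function.Injective f) (hfg : Function.Exact f g)
    (hg : Function.Surjective g) (hB : ((n + 1 : ℕ) : ℕ∞) ≤ depth R B)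
    (hC : (n : ℕ∞) ≤ depth R C) : ((n + 1 : ℕ) : ℕ∞) ≤ depth R A := by
  rw [natCast_le_depth_iff_subsingleton_ext] at *
  intro i hi
  have := hB i hi
  have hS := shortExact_of_exact hf hfg hg
  refine subsingleton_of_forall_eq 0 fun x => ?_
  obtain _ | i := i
  · have := hS.mono_f
    refine Abelian.Ext.postcomp_mk₀_injective_of_mono _ (ModuleCat.ofHom f) ?_
    exact Subsingleton.elim (α := Abelian.Ext _ (ModuleCat.of R B) 0) _ _
  · have := hC i (by omega)
    obtain ⟨y, rfl⟩ := Abelian.Ext.covariant_sequence_exact₁ _ hS x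
      (Subsingleton.elim (α := Abelian.Ext _ (ModuleCat.of R B) (i + 1)) _ _) rfl
    rw [Subsingleton.elim (α := Abelian.Ext _ (ModuleCat.of R C) i) y 0]
    simp

theorem natCast_le_depth_right (hf : Function.Injective f) (hfg : Function.Exact f g)
    (hg : Function.Surjective g) (hA : ((n + 1 : ℕ) : ℕ∞) ≤ depth R A)
    (hB : (n : ℕ∞) ≤ depth R B) : (n : ℕ∞) ≤ depth R C := by
  rw [natCast_le_depth_iff_subsingleton_ext] at *
  intro i hi
  have := hB i hi
  have := hA (i + 1) (by omega)
  refine subsingleton_of_forall_eq 0 fun x => ?_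
  obtain ⟨y, rfl⟩ := Abelian.Ext.covariant_sequence_exact₃ _ (shortExact_of_exact hf hfg hg) x
    rfl (Subsingleton.elim (α := Abelian.Ext _ (ModuleCat.of R A) (i + 1)) _ _)
  rw [Subsingleton.elim (α := Abelian.Ext _ (ModuleCat.of R B) i) y 0]
  simp

end ShortExact

/-! ### Modules that are locally free on the punctured spectrum -/

/-- Multiplication by `s` on `M` factors through a finitely generated free module. -/
def FactorsThroughFree {R : Type u} [CommRing R] (M : Type v) [AddCommGroup M] [Module R M]
    (s : R) : Prop :=
  ∃ (r : ℕ) (α : M →ₗ[R] (Fin r → R)) (β : (Fin r → R) →ₗ[R] M), ∀ z, β (α z) = s • z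

/-- For every `x ∈ 𝔪`, multiplication by some power of `x` on `M` factors through a finitely
generated free module. -/
def IsPuncturedFree (R : Type u) [CommRing R] [IsLocalRing R] (M : Type v) [AddCommGroup M]
    [Module R M] : Prop :=
  ∀ x ∈ maximalIdeal R, ∃ k : ℕ, FactorsThroughFree M (x ^ k)

section Basic

variable {R : Type u} [CommRing R] {M : Type v} [AddCommGroup M] [Module R M]

theorem FactorsThroughFree.of_free {F : Type*} [AddCommGroup F] [Module R F] [Module.Finite R F]
    [Module.Free R F] {s : R} (α : M →ₗ[R] F) (β : F →ₗ[R] M) (h : ∀ z, β (α z) = s • z) :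
    FactorsThroughFree M s := by
  rcases subsingleton_or_nontrivial R with hR | hR
  · have := Module.subsingleton R M
    exact ⟨0, 0, 0, fun z => Subsingleton.elim _ _⟩
  let e := (Module.finBasis R F).equivFun
  exact ⟨_, e.toLinearMap ∘ₗ α, β ∘ₗ e.symm.toLinearMap, fun z => by simp [h]⟩

variable (R M) in
/-- The ideal of all `s` such that multiplication by `s` on `M` factors through a finitely
generated free module. -/
def freeFactorIdeal : Ideal R where
  carrier := {s | FactorsThroughFree M s}
  zero_mem' := ⟨0, 0, 0, fun z => by simp⟩
  add_mem' := by
    rintro s t ⟨r, α, β, h⟩ ⟨r', α', β', h'⟩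
    exact .of_free (α.prod α') (β.coprod β') fun z => by simp [h, h', add_smul]
  smul_mem' := by
    rintro c s ⟨r, α, β, h⟩
    exact ⟨r, α, c • β, fun z => by simp [h, mul_smul]⟩

/-- A basis isomorphism at `𝔭` and its inverse both lift to maps over `R` after clearing
denominators `s` and `t`. The composite agrees with `t * s` only after localizing, hence the further
factor `w`. -/
theorem exists_factorsThroughFree_of_free_localization [IsNoetherianRing R] [Module.Finite R M]
    (p : Ideal R) [p.IsPrime]
    [Module.Free (Localization.AtPrime p) (LocalizedModule.AtPrime p M)] :
    ∃ s ∉ p, FactorsThroughFree M s := by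
  have : Module.Finite (Localization.AtPrime p) (LocalizedModule.AtPrime p M) := inferInstance
  let e := (Module.finBasis (Localization.AtPrime p)
    (LocalizedModule.AtPrime p M)).equivFun.restrictScalars R
  let f := LocalizedModule.mkLinearMap p.primeCompl M
  let r := Module.finrank (Localization.AtPrime p) (LocalizedModule.AtPrime p M)
  let g : (Fin r → R) →ₗ[R] (Fin r → Localization.AtPrime p) :=
    LinearMap.pi fun i => Algebra.linearMap R _ ∘ₗ LinearMap.proj i
  have hg : IsLocalizedModule p.primeCompl g := inferInstance
  have : Module.FinitePresentation R M := Module.finitePresentation_of_finite R M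
  obtain ⟨α, s, hα⟩ := Module.FinitePresentation.exists_lift_of_isLocalizedModule
    p.primeCompl g (e.toLinearMap ∘ₗ f)
  obtain ⟨β, t, hβ⟩ := Module.FinitePresentation.exists_lift_of_isLocalizedModule
    p.primeCompl f (e.symm.toLinearMap ∘ₗ g)
  obtain ⟨w, hw⟩ := Module.Finite.exists_smul_of_comp_eq_of_isLocalizedModule p.primeCompl f
    (β ∘ₗ α) ((t * s) • LinearMap.id) <| by
      ext z
      have h1 : g (α z) = s • e (f z) := LinearMap.congr_fun hα z
      have h2 : f (β (α z)) = t • e.symm (g (α z)) := LinearMap.congr_fun hβ _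
      have h3 : e.symm (s • e (f z)) = s • f z := by
        rw [Submonoid.smul_def, Submonoid.smul_def, map_smul, e.symm_apply_apply]
      change f (β (α z)) = f ((t * s) • z)
      rw [h2, h1, h3, Submonoid.smul_def, Submonoid.smul_def, Submonoid.smul_def, map_smul,
        Submonoid.coe_mul, mul_smul]
  refine ⟨w * (t * s), (w * (t * s)).2, r, α, (w : R) • β, fun z => ?_⟩
  have := LinearMap.congr_fun hw z
  simpa [Submonoid.smul_def, mul_smul] using this

/-- Since `s` becomes a unit at `𝔭`, `M_𝔭` is a direct summand of a free module, and finite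
projectives over a local ring are free. -/
theorem free_localization_of_factorsThroughFree [Module.Finite R M] (p : Ideal R) [p.IsPrime]
    {s : R} (hs : s ∉ p) (h : FactorsThroughFree M s) :
    Module.Free (Localization.AtPrime p) (LocalizedModule.AtPrime p M) := by
  obtain ⟨r, α, β, h⟩ := h
  let A := LocalizedModule.map p.primeCompl α
  let B := LocalizedModule.map p.primeCompl β
  let f := LocalizedModule.mkLinearMap p.primeCompl M
  have hu : IsUnit (algebraMap R (Localization.AtPrime p) s) :=
    IsLocalization.map_units (M := p.primeCompl) _ ⟨s, hs⟩
  obtain ⟨c, hc⟩ := hu.exists_left_inv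
  have : Module.Projective (Localization.AtPrime p)
      (LocalizedModule p.primeCompl (Fin r → R)) :=
    Module.projective_of_isLocalizedModule p.primeCompl (LocalizedModule.mkLinearMap _ _)
  have : Module.Projective (Localization.AtPrime p) (LocalizedModule.AtPrime p M) := by
    refine Module.Projective.of_split A (c • B) (LinearMap.ext fun z => ?_)
    induction z using LocalizedModule.induction_on with
    | h m t =>
      change c • B (A (LocalizedModule.mk m t)) = LocalizedModule.mk m t
      have : B (A (LocalizedModule.mk m t)) =
          algebraMap R (Localization.AtPrime p) s • LocalizedModule.mk m t := by
        simp only [A, B, LocalizedModule.map_mk, h, algebraMap_smul, LocalizedModule.smul'_mk]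
      rw [this, smul_smul, hc, one_smul]
  exact Module.free_of_flat_of_isLocalRing

end Basic

/-- If `M` is locally free on the punctured spectrum, no prime other than `𝔪` contains
`freeFactorIdeal R M`, so its radical contains `𝔪`. Conversely, a non-maximal prime misses some `x ∈
𝔪` and all its powers. -/
theorem modZero_iff {R : Type u} [CommRing R] [IsLocalRing R] [IsNoetherianRing R]
    (M : ModuleCat.{u} R) : modZero R M ↔ Module.Finite R M ∧ IsPuncturedFree R M := by
  refine and_congr_right fun hfin => ⟨fun h x hx => ?_, fun h p hp hmax => ?_⟩
  · suffices hx : x ∈ (freeFactorIdeal R M).radical from hx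
    rw [Ideal.radical_eq_sInf, Ideal.mem_sInf]
    rintro p ⟨hp, hprime⟩
    by_contra hxp
    have hmax : ¬ p.IsMaximal := fun hmax => hxp (by rwa [eq_maximalIdeal hmax])
    have := h p hmax
    obtain ⟨s, hs, hM⟩ := exists_factorsThroughFree_of_free_localization (M := M) p
    exact hs (hp hM)
  · obtain ⟨x, hx, hxp⟩ : ∃ x ∈ maximalIdeal R, x ∉ p := by
      by_contra! hle
      have : p = maximalIdeal R := le_antisymm (le_maximalIdeal hp.ne_top) hle
      exact hmax (this ▸ inferInstance)
    obtain ⟨k, hk⟩ := h x hx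
    exact free_localization_of_factorsThroughFree p (fun h => hxp (hp.mem_of_pow_mem k h)) hk

/-! ### Extending linear forms, and permanence on the punctured spectrum -/

section DualSurjective

variable {R : Type u} [CommRing R] {A B : Type u} [AddCommGroup A] [Module R A]
  [AddCommGroup B] [Module R B] {f : A →ₗ[R] B}

/-- Every linear form on `A` extends along `f`. -/
def DualSurjective (f : A →ₗ[R] B) : Prop :=
  ∀ φ : Module.Dual R A, ∃ ψ : Module.Dual R B, ψ ∘ₗ f = φ

theorem DualSurjective.exists_extension (hf : DualSurjective f) {r : ℕ}
    (α : A →ₗ[R] (Fin r → R)) : ∃ α' : B →ₗ[R] (Fin r → R), α' ∘ₗ f = α := by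
  choose ψ hψ using fun i => hf (LinearMap.proj i ∘ₗ α)
  exact ⟨LinearMap.pi ψ, LinearMap.ext fun z => funext fun i => LinearMap.congr_fun (hψ i) z⟩

end DualSurjective

section ShortExact

variable {R : Type u} [CommRing R] [IsLocalRing R] {A B C : Type u} [AddCommGroup A] [Module R A]
  [AddCommGroup B] [Module R B] [AddCommGroup C] [Module R C] {f : A →ₗ[R] B} {g : B →ₗ[R] C}

/-- Extend `α` to `α'` on `B`. Then `x ^ k - f β α'` vanishes on the image of `f`, so it descends to
`γ : C → B`, and `g γ = x ^ k` because `g f = 0`. -/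
theorem IsPuncturedFree.of_dualSurjective [Module.Finite R B] [Module.Free R B]
    (hA : IsPuncturedFree R A) (hf : DualSurjective f) (hfg : Function.Exact f g)
    (hg : Function.Surjective g) : IsPuncturedFree R C := by
  intro x hx
  obtain ⟨k, r, α, β, h⟩ := hA x hx
  obtain ⟨α', hα'⟩ := hf.exists_extension α
  let δ : B →ₗ[R] B := x ^ k • LinearMap.id - f ∘ₗ β ∘ₗ α'
  have hδ : LinearMap.ker g ≤ LinearMap.ker δ := by
    intro b hb
    obtain ⟨a, rfl⟩ := (hfg b).mp hb
    have h1 : α' (f a) = α a := LinearMap.congr_fun hα' a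
    simp [δ, h1, h]
  let γ : C →ₗ[R] B :=
    (LinearMap.ker g).liftQ δ hδ ∘ₗ (g.quotKerEquivOfSurjective hg).symm.toLinearMap
  refine ⟨k, .of_free γ g fun c => ?_⟩
  obtain ⟨b, rfl⟩ := hg c
  have hγ : γ (g b) = δ b := by
    have : (g.quotKerEquivOfSurjective hg).symm (g b) = (LinearMap.ker g).mkQ b := by
      rw [LinearEquiv.symm_apply_eq]; rfl
    simp [γ, this]
  rw [hγ]
  simp [δ, hfg.apply_apply_eq_zero]

/-- Dual to the cokernel argument: lift `β` to `β'` along `g`. Then `x ^ k - β' α g` lands in `ker g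
= A`, and it restricts to `x ^ k` on `A`. -/
theorem IsPuncturedFree.of_syzygy [Module.Finite R B] [Module.Projective R B]
    (hC : IsPuncturedFree R C) (hf : Function.Injective f) (hfg : Function.Exact f g)
    (hg : Function.Surjective g) : IsPuncturedFree R A := by
  have : Module.Free R B := Module.free_of_flat_of_isLocalRing
  intro x hx
  obtain ⟨k, r, α, β, h⟩ := hC x hx
  obtain ⟨β', hβ'⟩ := Module.projective_lifting_property g β hg
  let δ : B →ₗ[R] B := x ^ k • LinearMap.id - β' ∘ₗ α ∘ₗ g
  have hδ : ∀ b, δ b ∈ LinearMap.range f := fun b => by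
    have h1 : ∀ z, g (β' z) = β z := LinearMap.congr_fun hβ'
    refine (hfg _).mp ?_
    simp [δ, h1, h]
  let ε : B →ₗ[R] A := (LinearEquiv.ofInjective f hf).symm.toLinearMap ∘ₗ δ.codRestrict _ hδ
  refine ⟨k, .of_free f ε fun a => hf ?_⟩
  have hε : ∀ b, f (ε b) = δ b := fun b => by
    change (LinearEquiv.ofInjective f hf ((LinearEquiv.ofInjective f hf).symm _) : B) = _
    rw [LinearEquiv.apply_symm_apply]
    rfl
  rw [hε]
  simp [δ, hfg.apply_apply_eq_zero]

/-- As `α` extends along `f`, it kills `ker f`; hence so does `x ^ k = β α`, and `x` can be chosen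
regular on `A`. -/
theorem IsPuncturedFree.injective_of_dualSurjective (hA : IsPuncturedFree R A)
    (hf : DualSurjective f) (hdepth : 1 ≤ depth R A) : Function.Injective f := by
  obtain ⟨x, hx, hreg⟩ : ∃ x ∈ maximalIdeal R, IsSMulRegular A x := by
    have hlt : (0 : ℕ∞) < depth R A := lt_of_lt_of_le zero_lt_one hdepth
    obtain ⟨_, ⟨rs, hrs, hreg, rfl⟩, hn⟩ := lt_sSup_iff.mp hlt
    cases rs with
    | nil => simp at hn
    | cons x rs =>
      exact ⟨x, hrs x (by simp), ((RingTheory.Sequence.isWeaklyRegular_cons_iff _ _ _).mp hreg).1⟩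
  obtain ⟨k, r, α, β, h⟩ := hA x hx
  obtain ⟨α', rfl⟩ := hf.exists_extension α
  refine (injective_iff_map_eq_zero f).mpr fun z hz => (hreg.pow k).right_eq_zero_of_smul ?_
  rw [← h]
  simp [hz]

end ShortExact

/-! ### Torsionfree modules through iterated pushforwards -/

/-! ### Dimension shifting, and `Ext¹` as an obstruction to extending maps -/

section Ext

variable {R : Type u} [CommRing R] {A B C Y : Type u} [AddCommGroup A] [Module R A]
  [AddCommGroup B] [Module R B] [AddCommGroup C] [Module R C] [AddCommGroup Y] [Module R Y]
  {f : A →ₗ[R] B} {g : B →ₗ[R] C}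

theorem subsingleton_ext_succ_succ_iff [Module.Projective R B] (hf : Function.Injective f)
    (hfg : Function.Exact f g) (hg : Function.Surjective g) (i : ℕ) :
    Subsingleton (Abelian.Ext (ModuleCat.of R C) (ModuleCat.of R Y) (i + 2)) ↔
      Subsingleton (Abelian.Ext (ModuleCat.of R A) (ModuleCat.of R Y) (i + 1)) := by
  have hS := shortExact_of_exact hf hfg hg
  have hP : Projective (ModuleCat.of R B) :=
    (IsProjective.iff_projective _).mp inferInstance
  constructor
  · intro h
    refine subsingleton_of_forall_eq 0 fun x => ?_
    obtain ⟨y, rfl⟩ := Abelian.Ext.contravariant_sequence_exact₁ hS _ x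
      (by omega : 1 + (i + 1) = i + 2)
      (Subsingleton.elim (α := Abelian.Ext (ModuleCat.of R C) _ (i + 2)) _ _)
    rw [Abelian.Ext.eq_zero_of_projective (P := ModuleCat.of R B) y]
    simp
  · intro h
    refine subsingleton_of_forall_eq 0 fun x => ?_
    obtain ⟨y, rfl⟩ := Abelian.Ext.contravariant_sequence_exact₃ hS _ x
      (Abelian.Ext.eq_zero_of_projective (P := ModuleCat.of R B) _)
      (by omega : 1 + (i + 1) = i + 2)
    rw [Subsingleton.elim (α := Abelian.Ext (ModuleCat.of R A) _ (i + 1)) y 0]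
    simp

theorem subsingleton_ext_one_iff [Module.Projective R B] (hf : Function.Injective f)
    (hfg : Function.Exact f g) (hg : Function.Surjective g) :
    Subsingleton (Abelian.Ext (ModuleCat.of R C) (ModuleCat.of R Y) 1) ↔
      ∀ α : A →ₗ[R] Y, ∃ β : B →ₗ[R] Y, β ∘ₗ f = α := by
  have hS := shortExact_of_exact hf hfg hg
  have hP : Projective (ModuleCat.of R B) :=
    (IsProjective.iff_projective _).mp inferInstance
  constructor
  · intro h α
    obtain ⟨y, hy⟩ := Abelian.Ext.contravariant_sequence_exact₁ hS _
      (Abelian.Ext.mk₀ (ModuleCat.ofHom α)) (add_zero 1)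
      (Subsingleton.elim (α := Abelian.Ext (ModuleCat.of R C) _ 1) _ _)
    obtain ⟨β, rfl⟩ := Abelian.Ext.homEquiv₀.symm.surjective y
    refine ⟨β.hom, ?_⟩
    rw [Abelian.Ext.homEquiv₀_symm_apply, Abelian.Ext.mk₀_comp_mk₀] at hy
    exact congrArg ModuleCat.Hom.hom (Abelian.Ext.homEquiv₀.symm.injective hy)
  · intro h
    refine subsingleton_of_forall_eq 0 fun x => ?_
    obtain ⟨y, rfl⟩ := Abelian.Ext.contravariant_sequence_exact₃ hS _ x
      (Abelian.Ext.eq_zero_of_projective (P := ModuleCat.of R B) _) (add_zero 1)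
    obtain ⟨α, rfl⟩ := Abelian.Ext.homEquiv₀.symm.surjective y
    obtain ⟨β, hβ⟩ := h α.hom
    have : α = ModuleCat.ofHom f ≫ ModuleCat.ofHom β :=
      ModuleCat.hom_ext hβ.symm
    rw [Abelian.Ext.homEquiv₀_symm_apply, this, ← Abelian.Ext.mk₀_comp_mk₀]
    exact hS.extClass_comp_assoc _

end Ext

/-! ### The transpose of a cokernel -/

section Transpose

variable {R : Type u} [CommRing R] {F₁ F₀ F M : Type u} [AddCommGroup F₁] [Module R F₁]
  [AddCommGroup F₀] [Module R F₀] [AddCommGroup F] [Module R F] [AddCommGroup M] [Module R M]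
  {d : F₁ →ₗ[R] F₀} {π : F₀ →ₗ[R] M} {j : M →ₗ[R] F}

/-- The kernel of `d*` consists of the forms that factor through `M`, and these extend along `j`. -/
theorem exact_dualMap_of_dualSurjective (hπ : Function.Surjective π) (hd : Function.Exact d π)
    (hj : DualSurjective j) : Function.Exact (j ∘ₗ π).dualMap d.dualMap := by
  intro φ
  constructor
  · intro h
    have hker : LinearMap.ker π ≤ LinearMap.ker φ := fun y hy => by
      obtain ⟨z, rfl⟩ := (hd y).mp hy
      exact LinearMap.congr_fun h z
    obtain ⟨ψ, hψ⟩ := hj ((LinearMap.ker π).liftQ φ hker ∘ₗ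
      (π.quotKerEquivOfSurjective hπ).symm.toLinearMap)
    refine ⟨ψ, LinearMap.ext fun y => ?_⟩
    have : (π.quotKerEquivOfSurjective hπ).symm (π y) = (LinearMap.ker π).mkQ y := by
      rw [LinearEquiv.symm_apply_eq]; rfl
    have h2 := LinearMap.congr_fun hψ (π y)
    simpa [this] using h2
  · rintro ⟨ψ, rfl⟩
    ext z
    simp [hd.apply_apply_eq_zero]

variable (d j π) in
/-- The map from the cokernel of `(j ∘ π)*` to `F₁*` induced by `d*`. -/
def cokerDual (h : Function.Exact (j ∘ₗ π).dualMap d.dualMap) :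
    (Module.Dual R F₀ ⧸ LinearMap.range (j ∘ₗ π).dualMap) →ₗ[R] Module.Dual R F₁ :=
  Submodule.liftQ _ d.dualMap (LinearMap.exact_iff.mp h).ge

theorem injective_cokerDual (h : Function.Exact (j ∘ₗ π).dualMap d.dualMap) :
    Function.Injective (cokerDual d π j h) := by
  rw [← LinearMap.ker_eq_bot, cokerDual, Submodule.ker_liftQ, LinearMap.exact_iff.mp h]
  simp

theorem exact_cokerDual (h : Function.Exact (j ∘ₗ π).dualMap d.dualMap) :
    Function.Exact (cokerDual d π j h) (LinearMap.range d.dualMap).mkQ := by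
  rw [LinearMap.exact_iff, Submodule.ker_mkQ, cokerDual, Submodule.range_liftQ]

/-- By reflexivity of `F₀` and `F₁`, linear forms on the cokernel are elements of `ker (jπ)`, and
those extending to `F₁*` are the elements of `im d = ker π`. The obstruction is thus `ker (jπ) / ker
π`, that is, `ker j`. -/
theorem forall_exists_comp_cokerDual_iff [Module.Finite R F₁] [Module.Free R F₁]
    [Module.Free R F₀] [Module.Free R F] (hπ : Function.Surjective π)
    (hd : Function.Exact d π) (hj : DualSurjective j) [Module.Finite R F₀] :
    (∀ α : (Module.Dual R F₀ ⧸ LinearMap.range (j ∘ₗ π).dualMap) →ₗ[R] R,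
      ∃ β : Module.Dual R F₁ →ₗ[R] R,
        β ∘ₗ cokerDual d π j (exact_dualMap_of_dualSurjective hπ hd hj) = α) ↔
      Function.Injective j := by
  constructor
  · intro h
    refine (injective_iff_map_eq_zero j).mpr fun z hz => ?_
    obtain ⟨x, rfl⟩ := hπ z
    obtain ⟨β, hβ⟩ := h (Submodule.liftQ _ (Module.Dual.eval R F₀ x) (by
      rintro _ ⟨ψ, rfl⟩
      simp [hz]))
    obtain ⟨y, rfl⟩ := (Module.evalEquiv R F₁).surjective β
    have : d y = x := by
      rw [← sub_eq_zero, ← Module.forall_dual_apply_eq_zero_iff R]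
      intro φ
      have := LinearMap.congr_fun hβ (Submodule.mkQ _ φ)
      simpa [cokerDual, sub_eq_zero] using this
    rw [← this, hd.apply_apply_eq_zero]
  · intro h α
    obtain ⟨x, hx⟩ := (Module.evalEquiv R F₀).surjective (α ∘ₗ Submodule.mkQ _)
    have hx' : ∀ φ : Module.Dual R F₀, φ x = α (Submodule.mkQ _ φ) := LinearMap.congr_fun hx
    have hjx : j (π x) = 0 := by
      rw [← Module.forall_dual_apply_eq_zero_iff R]
      intro ψ
      have : Submodule.mkQ (LinearMap.range (j ∘ₗ π).dualMap) ((j ∘ₗ π).dualMap ψ) = 0 := by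
        simp
      have h2 := hx' ((j ∘ₗ π).dualMap ψ)
      rw [this, map_zero] at h2
      exact h2
    obtain ⟨y, rfl⟩ := (hd x).mp (h (hjx.trans (map_zero j).symm))
    refine ⟨Module.Dual.eval R F₁ y, ?_⟩
    refine Submodule.linearMap_qext _ (LinearMap.ext fun φ => ?_)
    simpa [cokerDual] using hx' φ

end Transpose

/-- `M` admits `n` successive pushforwards: embeddings into finitely generated free modules along
which all linear forms extend, each starting from the cokernel of the one before. -/
def HasPushforwards {R : Type u} [CommRing R] : ℕ → ModuleCat.{u} R → Prop
  | 0, _ => True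
  | n + 1, M => ∃ (F : ModuleCat.{u} R) (j : M →ₗ[R] F), Module.Finite R F ∧ Module.Free R F ∧
      Function.Injective j ∧ DualSurjective j ∧
      HasPushforwards n (ModuleCat.of R (F ⧸ LinearMap.range j))

/-- The components of `j` are finitely many generators of the dual of `M`. -/
theorem exists_dualSurjective {R : Type u} [CommRing R] [IsNoetherianRing R] (M : Type u)
    [AddCommGroup M] [Module R M] [Module.Finite R M] :
    ∃ (k : ℕ) (j : M →ₗ[R] (Fin k → R)), DualSurjective j := by
  obtain ⟨k, s, hs⟩ := Module.Finite.exists_fin' R (Module.Dual R M)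
  refine ⟨k, LinearMap.pi fun i => s (Pi.single i 1), fun φ => ?_⟩
  obtain ⟨a, rfl⟩ := hs φ
  refine ⟨∑ i, a i • LinearMap.proj i, LinearMap.ext fun z => ?_⟩
  have hsingle : ∀ i : Fin k, (fun l => if i = l then (1 : R) else 0) = Pi.single i 1 :=
    fun i => by ext l; simp [Pi.single_apply, eq_comm]
  rw [LinearMap.pi_apply_eq_sum_univ s a]
  simp [hsingle]

/-- Arbitrary finite free presentations are needed for the induction: the next step uses `F₀ → F →
coker j`, which is not minimal in general. -/
theorem subsingleton_ext_coker_dualMap_iff {R : Type u} [CommRing R] [IsNoetherianRing R] (n : ℕ) :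
    ∀ {F₁ F₀ M : Type u} [AddCommGroup F₁] [Module R F₁] [AddCommGroup F₀] [Module R F₀]
      [AddCommGroup M] [Module R M] [Module.Finite R F₁] [Module.Free R F₁] [Module.Finite R F₀]
      [Module.Free R F₀] (d : F₁ →ₗ[R] F₀) (π : F₀ →ₗ[R] M), Function.Surjective π →
      Function.Exact d π →
      ((∀ i, 1 ≤ i → i ≤ n → Subsingleton (Abelian.Ext
        (ModuleCat.of R (Module.Dual R F₁ ⧸ LinearMap.range d.dualMap))
        (ModuleCat.of R R) i)) ↔ HasPushforwards n (ModuleCat.of R M)) := by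
  induction n with
  | zero =>
    intros
    exact iff_of_true (fun i h1 h2 => by omega) trivial
  | succ n ih =>
    intro F₁ F₀ M _ _ _ _ _ _ _ _ _ _ d π hπ hd
    -- Any `j` along which linear forms extend will do: one direction chooses `j` from generators of
    -- the dual, the other is handed a `j`.
    have key : ∀ (F : Type u) [AddCommGroup F] [Module R F] [Module.Finite R F]
        [Module.Free R F] (j : M →ₗ[R] F), DualSurjective j →
        ((∀ i, 1 ≤ i → i ≤ n + 1 → Subsingleton (Abelian.Ext
          (ModuleCat.of R (Module.Dual R F₁ ⧸ LinearMap.range d.dualMap))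
          (ModuleCat.of R R) i)) ↔ Function.Injective j ∧
            HasPushforwards n (ModuleCat.of R (F ⧸ LinearMap.range j))) := by
      intro F _ _ _ _ j hj
      have hex := exact_dualMap_of_dualSurjective hπ hd hj
      rw [← ih (j ∘ₗ π) (LinearMap.range j).mkQ (Submodule.mkQ_surjective _) (by
          rw [LinearMap.exact_iff, Submodule.ker_mkQ, LinearMap.range_comp_of_range_eq_top j
            (LinearMap.range_eq_top.mpr hπ)]),
        ← forall_exists_comp_cokerDual_iff hπ hd hj,
        ← subsingleton_ext_one_iff (injective_cokerDual hex) (exact_cokerDual hex)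
          (Submodule.mkQ_surjective _)]
      have hshift := subsingleton_ext_succ_succ_iff (Y := R) (injective_cokerDual hex)
        (exact_cokerDual hex) (Submodule.mkQ_surjective _)
      constructor
      · intro h
        refine ⟨h 1 le_rfl (by omega), fun i h1 h2 => ?_⟩
        obtain ⟨i, rfl⟩ := Nat.exists_eq_add_of_le' h1
        exact (hshift i).mp (h (i + 2) (by omega) (by omega))
      · rintro ⟨h0, h⟩ i h1 h2
        obtain _ | _ | i := i
        · omega
        · exact h0
        · exact (hshift i).mpr (h (i + 1) (by omega) (by omega))
    constructor
    · intro h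
      have : Module.Finite R M := .of_surjective π hπ
      obtain ⟨k, j, hj⟩ := exists_dualSurjective (R := R) M
      obtain ⟨hinj, hn⟩ := (key (Fin k → R) j hj).mp h
      exact ⟨ModuleCat.of R (Fin k → R), j, inferInstanceAs (Module.Finite R (Fin k → R)),
        inferInstanceAs (Module.Free R (Fin k → R)), hinj, hj, hn⟩
    · rintro ⟨F, j, hF, hF', hinj, hj, hn⟩
      exact (key F j hj).mpr ⟨hinj, hn⟩

theorem isTorsionfree_iff {R : Type u} [CommRing R] [IsLocalRing R] [IsNoetherianRing R] (n : ℕ)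
    (M : ModuleCat.{u} R) [Module.Finite R M] :
    IsTorsionfree n R M ↔ HasPushforwards n M :=
  subsingleton_ext_coker_dualMap_iff n (nonempty_minimalPresentation R M).some.d
    (nonempty_minimalPresentation R M).some.π
    (nonempty_minimalPresentation R M).some.surjective_π
    (nonempty_minimalPresentation R M).some.exact

/-! ### The comparison theorems -/

theorem exact_mkQ_range {R : Type u} [CommRing R] {A B : Type u} [AddCommGroup A]
    [Module R A] [AddCommGroup B] [Module R B] (f : A →ₗ[R] B) :
    Function.Exact f (LinearMap.range f).mkQ := by
  rw [LinearMap.exact_iff, Submodule.ker_mkQ]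

/-- The cokernel of `(j, f) : A → F × B` maps onto the cokernel of `f` with kernel `F`. -/
theorem exists_exact_coker_prod {R : Type u} [CommRing R] {A B C F : Type u}
    [AddCommGroup A] [Module R A] [AddCommGroup B] [Module R B] [AddCommGroup C] [Module R C]
    [AddCommGroup F] [Module R F] {f : A →ₗ[R] B} {g : B →ₗ[R] C} (hf : Function.Injective f) (hfg : Function.Exact f g)
    (hg : Function.Surjective g) (j : A →ₗ[R] F) :
    ∃ (a : F →ₗ[R] (F × B) ⧸ LinearMap.range (j.prod f))
      (b : ((F × B) ⧸ LinearMap.range (j.prod f)) →ₗ[R] C),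
      Function.Injective a ∧ Function.Exact a b ∧ Function.Surjective b := by
  refine ⟨Submodule.mkQ _ ∘ₗ LinearMap.inl R F B,
    Submodule.liftQ _ (g ∘ₗ LinearMap.snd R F B) ?_, ?_, ?_, ?_⟩
  · rintro _ ⟨z, rfl⟩
    simp [hfg.apply_apply_eq_zero]
  · refine (injective_iff_map_eq_zero _).mpr fun y hy => ?_
    obtain ⟨z, hz⟩ := (Submodule.Quotient.mk_eq_zero _).mp hy
    have h1 : j z = y := congrArg Prod.fst hz
    have h2 : f z = 0 := congrArg Prod.snd hz
    rw [← h1, hf (h2.trans (map_zero f).symm), map_zero]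
  · intro y
    obtain ⟨⟨x, y⟩, rfl⟩ := Submodule.mkQ_surjective _ y
    constructor
    · intro h
      obtain ⟨z, rfl⟩ := (hfg y).mp h
      refine ⟨x - j z, (Submodule.Quotient.eq _).mpr ⟨-z, ?_⟩⟩
      simp
    · rintro ⟨w, hw⟩
      rw [← hw]
      simp
  · intro c
    obtain ⟨y, rfl⟩ := hg c
    exact ⟨Submodule.mkQ _ (0, y), by simp⟩

/-! ### Local conditions reduce to the closed point -/

theorem ringKrullDim_localization_of_isMaximal {R : Type u} [CommRing R] [IsLocalRing R]
    (p : Ideal R) [p.IsPrime] (hp : p.IsMaximal) :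
    ringKrullDim (Localization.AtPrime p) = ringKrullDim R := by
  obtain rfl : p = maximalIdeal R := eq_maximalIdeal hp
  rw [IsLocalization.AtPrime.ringKrullDim_eq_height (maximalIdeal R),
    IsLocalRing.maximalIdeal_height_eq_ringKrullDim]

theorem depthAt_self_le_of_modZero {R : Type u} [CommRing R] {M : ModuleCat.{u} R}
    (hM : modZero R M) (p : Ideal R) [p.IsPrime] (hp : ¬ p.IsMaximal) :
    depthAt p R ≤ depthAt p M := by
  have := hM.2 p hp
  have : Module.Flat (Localization.AtPrime p) (LocalizedModule.AtPrime p M) :=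
    Module.Flat.of_free
  have e : LocalizedModule.AtPrime p R ≃ₗ[Localization.AtPrime p] Localization.AtPrime p :=
    LinearEquiv.refl _ _
  exact (depth_congr e).le.trans (depth_le_depth_of_flat (LocalizedModule.AtPrime p M))

theorem IsCohenMacaulay.natCast_le_depth {R : Type u} [CommRing R] [IsLocalRing R] {d : ℕ}
    (hd : ringKrullDim R = d) (h : IsCohenMacaulay R) : (d : ℕ∞) ≤ depth R R := by
  have := h.2 (maximalIdeal R)
  rw [ringKrullDim_localization_of_isMaximal _ inferInstance, hd] at this
  have h2 : depthAt (maximalIdeal R) (ModuleCat.of R R) = depth R R :=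
    depthAt_maximalIdeal _ inferInstance R
  rw [h2] at this
  exact WithBot.coe_le_coe.mp this

theorem STildeZero_eq_modZeroDepthGE {R : Type u} [CommRing R] [IsLocalRing R] {n : ℕ}
    (hn : (n : ℕ∞) ≤ depth R R) :
    STildeZero R n = modZeroDepthGE R n := by
  ext M
  refine ⟨fun h => ⟨h.2, ?_⟩, fun h => ⟨⟨h.1.1, fun p hp => ?_⟩, h.1⟩⟩
  · have := h.1.2 (maximalIdeal R)
    rwa [depthAt_maximalIdeal _ inferInstance, depthAt_maximalIdeal _ inferInstance,
      min_eq_left hn] at this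
  · by_cases hmax : p.IsMaximal
    · rw [depthAt_maximalIdeal p hmax M]
      exact (min_le_left _ _).trans h.2
    · exact (min_le_right _ _).trans (depthAt_self_le_of_modZero h.1 p hmax)

theorem IsCohenMacaulay.CMZero_eq_modZeroDepthGE {R : Type u} [CommRing R] [IsLocalRing R]
    {d : ℕ} (hd : ringKrullDim R = d) (hR : IsCohenMacaulay R) : CMZero R = modZeroDepthGE R d := by
  ext M
  refine ⟨fun h => ⟨h.2, ?_⟩, fun h => ⟨⟨h.1.1, fun p hp => ?_⟩, h.1⟩⟩
  · have := h.1.2 (maximalIdeal R)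
    rw [ringKrullDim_localization_of_isMaximal _ inferInstance, hd,
      depthAt_maximalIdeal _ inferInstance] at this
    exact WithBot.coe_le_coe.mp this
  · by_cases hmax : p.IsMaximal
    · rw [ringKrullDim_localization_of_isMaximal p hmax, hd, depthAt_maximalIdeal p hmax M]
      exact WithBot.coe_le_coe.mpr h.2
    · exact (hR.2 p).trans (WithBot.coe_le_coe.mpr (depthAt_self_le_of_modZero h.1 p hmax))

/-! ### Torsionfreeness, depth and syzygies -/

section Main

variable {R : Type u} [CommRing R] [IsLocalRing R] [IsNoetherianRing R]

theorem TF_iff (n : ℕ) (M : ModuleCat.{u} R) :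
    TF R n M ↔ Module.Finite R M ∧ HasPushforwards n M :=
  ⟨fun ⟨h, h'⟩ => ⟨h, (isTorsionfree_iff n M).mp h'⟩,
    fun ⟨h, h'⟩ => ⟨h, (isTorsionfree_iff n M).mpr h'⟩⟩

theorem TFZero_iff (n : ℕ) (M : ModuleCat.{u} R) :
    TFZero R n M ↔ Module.Finite R M ∧ IsPuncturedFree R M ∧ HasPushforwards n M := by
  change TF R n M ∧ modZero R M ↔ _
  rw [TF_iff, modZero_iff]
  tauto

/-- For modules that are locally free on the punctured spectrum and `n ≤ depth R`, being
`n`-torsionfree means having depth at least `n`. -/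
theorem hasPushforwards_iff_natCast_le_depth (n : ℕ) (hn : (n : ℕ∞) ≤ depth R R) :
    ∀ (M : ModuleCat.{u} R) [Module.Finite R M], IsPuncturedFree R M →
      (HasPushforwards n M ↔ (n : ℕ∞) ≤ depth R M) := by
  induction n with
  | zero => exact fun M _ _ => iff_of_true trivial (by simp)
  | succ n ih =>
    have hn' : (n : ℕ∞) ≤ depth R R := le_trans (by exact_mod_cast n.le_succ) hn
    intro M _ hM
    constructor
    · rintro ⟨F, j, _, _, hinj, hj, h⟩
      have hX := hM.of_dualSurjective hj (exact_mkQ_range j) (Submodule.mkQ_surjective _)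
      -- The hypothesis `n + 1 ≤ depth R` enters here: the free module `F` must not limit the depth
      -- of `M`.
      exact natCast_le_depth_left hinj (exact_mkQ_range j) (Submodule.mkQ_surjective _)
        (hn.trans (depth_le_depth_of_flat F)) ((ih hn' _ hX).mp h)
    · intro h
      obtain ⟨k, j, hj⟩ := exists_dualSurjective (R := R) M
      have hinj : Function.Injective j := hM.injective_of_dualSurjective hj
        (le_trans (by exact_mod_cast Nat.le_add_left 1 n) h)
      have hX := hM.of_dualSurjective hj (exact_mkQ_range j) (Submodule.mkQ_surjective _)
      refine ⟨ModuleCat.of R (Fin k → R), j, inferInstanceAs (Module.Finite R (Fin k → R)),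
        inferInstanceAs (Module.Free R (Fin k → R)), hinj, hj, (ih hn' _ hX).mpr ?_⟩
      exact natCast_le_depth_right hinj (exact_mkQ_range j) (Submodule.mkQ_surjective _) h
        (hn'.trans (depth_le_depth_of_flat (Fin k → R)))

/-- Linear forms need not extend along `f`, but they do along `(j, f)`, which remains injective. Its
cokernel has depth at least `n`, so it has `n` pushforwards; the depth criterion is never applied at
`n + 1`. -/
theorem hasPushforwards_succ_of_syzygy {n : ℕ} (hn : (n : ℕ∞) ≤ depth R R)
    {M X P : ModuleCat.{u} R}
    [Module.Finite R M] [Module.Finite R P] [Module.Projective R P] {f : M →ₗ[R] P}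
    {g : P →ₗ[R] X} (hf : Function.Injective f) (hfg : Function.Exact f g)
    (hg : Function.Surjective g) (hX : IsPuncturedFree R X) (h : HasPushforwards n X) :
    HasPushforwards (n + 1) M := by
  have : Module.Finite R X := .of_surjective g hg
  have : Module.Free R P := Module.free_of_flat_of_isLocalRing
  have hM : IsPuncturedFree R M := hX.of_syzygy hf hfg hg
  obtain ⟨k, j, hj⟩ := exists_dualSurjective (R := R) M
  have hj' : DualSurjective (j.prod f) := fun φ => by
    obtain ⟨ψ, rfl⟩ := hj φ
    exact ⟨ψ ∘ₗ LinearMap.fst R _ _, rfl⟩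
  obtain ⟨a, b, ha, hab, hb⟩ := exists_exact_coker_prod hf hfg hg j
  have hY := hM.of_dualSurjective hj' (exact_mkQ_range (j.prod f)) (Submodule.mkQ_surjective _)
  refine ⟨ModuleCat.of R ((Fin k → R) × P), j.prod f,
    inferInstanceAs (Module.Finite R ((Fin k → R) × P)),
    inferInstanceAs (Module.Free R ((Fin k → R) × P)),
    fun x y hxy => hf (congrArg Prod.snd hxy), hj',
    (hasPushforwards_iff_natCast_le_depth n hn _ hY).mpr ?_⟩
  exact natCast_le_depth_middle ha hab hb (hn.trans (depth_le_depth_of_flat (Fin k → R)))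
    ((hasPushforwards_iff_natCast_le_depth n hn X hX).mp h)

theorem TFZero_eq_modZeroDepthGE {n : ℕ} (hn : (n : ℕ∞) ≤ depth R R) :
    TFZero R n = modZeroDepthGE R n := by
  ext M
  change _ ↔ modZero R M ∧ _
  rw [TFZero_iff, modZero_iff, and_assoc]
  exact and_congr_right fun h => and_congr_right fun h' =>
    hasPushforwards_iff_natCast_le_depth n hn M h'

theorem TFZero_succ_eq_syzygy {n : ℕ} (hn : (n : ℕ∞) ≤ depth R R) :
    TFZero R (n + 1) = syzygy (TFZero R n) := by
  ext M
  rw [TFZero_iff]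
  constructor
  · rintro ⟨hfin, hM, F, j, hF, hF', hinj, hj, h⟩
    have hX := hM.of_dualSurjective hj (exact_mkQ_range j) (Submodule.mkQ_surjective _)
    exact ⟨hfin, ModuleCat.of R (F ⧸ LinearMap.range j), F, j, (LinearMap.range j).mkQ,
      (TFZero_iff _ _).mpr ⟨inferInstanceAs (Module.Finite R (F ⧸ LinearMap.range j)), hX, h⟩,
      hF, inferInstance, hinj, exact_mkQ_range j, Submodule.mkQ_surjective _⟩
  · rintro ⟨hfin, X, P, f, g, hX, hP, hP', hf, hfg, hg⟩
    obtain ⟨_, hX, h⟩ := (TFZero_iff _ _).mp hX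
    exact ⟨hfin, hX.of_syzygy hf hfg hg, hasPushforwards_succ_of_syzygy hn hf hfg hg hX h⟩

end Main

end LocalAlg

end

open LocalAlg
theorem mainTheorem12 {R : Type u} [CommRing R] [IsLocalRing R] [IsNoetherianRing R]
    (d : ℕ) (hd : ringKrullDim R = d) :
    (∀ n : ℕ, (n : ℕ∞) ≤ depth R R →
      TFZero R n = STildeZero R n ∧ STildeZero R n = modZeroDepthGE R n) ∧
    (∀ n : ℕ, (n : ℕ∞) ≤ depth R R →
      TFZero R (n + 1) = syzygy (TFZero R n) ∧ syzygy (TFZero R n) = syzygy (STildeZero R n)) ∧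
    (IsCohenMacaulay R →
      (TFZero R d = STildeZero R d ∧ STildeZero R d = CMZero R) ∧
      (TFZero R (d + 1) = syzygy (STildeZero R d) ∧
        syzygy (STildeZero R d) = syzygy (CMZero R))) := by
  have h1 : ∀ n : ℕ, (n : ℕ∞) ≤ depth R R → TFZero R n = STildeZero R n := fun n hn =>
    (TFZero_eq_modZeroDepthGE hn).trans (STildeZero_eq_modZeroDepthGE hn).symm
  refine ⟨fun n hn => ⟨h1 n hn, STildeZero_eq_modZeroDepthGE hn⟩,
    fun n hn => ⟨TFZero_succ_eq_syzygy hn, by rw [h1 n hn]⟩, fun hR => ?_⟩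
  have hn := hR.natCast_le_depth hd
  have h2 : STildeZero R d = CMZero R :=
    (STildeZero_eq_modZeroDepthGE hn).trans (hR.CMZero_eq_modZeroDepthGE hd).symm
  exact ⟨⟨h1 d hn, h2⟩, by rw [← h1 d hn]; exact TFZero_succ_eq_syzygy hn, by rw [h2]⟩
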